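/- \textbf{Setting.} There are $n$ bidders. Bidder $i$ draws a value $v_i\ge 0$ from a probability distribution $V_i$ on $[0,\infty)$, independently across bidders; write $\mathbf V=(V_i)_{i\in[n]}$. A strategy profile $\mathbf s=(s_i)_{i\in[n]}$ assigns (measurably) to every bidder $i$ and value $v$ a probability distribution $s_i(v)$ of bids on $[0,\infty)$; bidders randomize independently. A tie-breaking rule $\alpha$ (which identifies a first-price auction) assigns (measurably) to every bid profile $\mathbf b\in[0,\infty)^n$ a random winner $\alpha(\mathbf b)\in\operatorname{argmax}_i b_i$; the winner pays her bid and the others pay nothing. Let $$u_i^{\alpha,\mathbf s}(v,b)=(v-b)\cdot\Pr\big[\alpha(b,\mathbf s_{-i}(\mathbf v_{-i}))=i\big]$$ be the interim utility of bidder $i$ with value $v$ and bid $b$. For $\delta\ge 0$, $\mathbf s$ is a $\delta$-approximate Bayesian Nash Equilibrium for $(\mathbf V,\alpha)$ if for every bidder $i$, every $v\in\operatorname{supp}(V_i)$ and every deviation bid $b^*\ge 0$, $$\mathbb E_{b\sim s_i(v)}\big[u_i^{\alpha,\mathbf s}(v,b)\big]\ \ge\ u_i^{\alpha,\mathbf s}(v,b^*)-\delta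 ;$$ it is an exact Bayesian Nash Equilibrium (BNE) if this holds with $\delta=0$. The expected optimal and auction social welfares are $\mathsf{OPT}(\mathbf V,\alpha,\mathbf s)=\mathbb E[\max_i v_i]$ and $\mathsf{FPA}(\mathbf V,\alpha,\mathbf s)=\mathbb E[v_{\alpha(\mathbf s(\mathbf v))}]$ (in $[0,\infty]$). For distributions $D,\tilde D$ on $[0,\infty)$ with quantile functions $D^{-1},\tilde D^{-1}$, let $\mathsf{EMD}_\infty(D,\tilde D)=\sup\{|D^{-1}(q)-\tilde D^{-1}(q)|: q\in[0,1]\}$, where $|\infty-\infty|=0$. \textbf{Theorem.} Let $\mathbf V=(V_i)_{i\in[n]}$ be a product value distribution, $\alpha$ a tie-breaking rule, and $\mathbf s$ an exact BNE for $(\mathbf V,\alpha)$. Then for every $\delta>0$ there is a strategy profile $\mathbf s^*$ such that: \begin{enumerate} \item (closeness) $\mathsf{EMD}_\infty(s_i(v),s_i^*(v))\le\delta$ for every bidder $i$ and every $v\in\operatorname{supp}(V_i)$; \item (efficiency invariance) for every tie-breaking rule $\alpha^*$, $\mathsf{OPT}(\mathbf V,\alpha^*,\mathbf s^*)=\mathsf{OPT}(\mathbf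 V,\alpha,\mathbf s)$ and $\mathsf{FPA}(\mathbf V,\alpha^*,\mathbf s^*)=\mathsf{FPA}(\mathbf V,\alpha,\mathbf s)$; \item (universality) for every tie-breaking rule $\alpha^*$, $\mathbf s^*$ is a $\delta$-approximate BNE for $(\mathbf V,\alpha^*)$. \end{enumerate} -/

import Mathlib

open MeasureTheory ProbabilityTheory Set
open scoped NNReal ENNReal

noncomputable section

namespace FirstPriceAuction

/-- A first-price auction with `n` bidders, identified with its (randomized) allocation rule.
A non-negative bid profile `b` is sent to the law `toKernel b` of the allocated bidder, who is
always one of the highest bidders; the law is arbitrary when several bidders are highest. -/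
structure TieBreakingRule (n : ℕ) where
  toKernel : Kernel (Fin n → ℝ≥0) (Fin n)
  isMarkov : IsMarkovKernel toKernel
  firstPrice : ∀ b : Fin n → ℝ≥0, ∀ᵐ w ∂(toKernel b), ∀ j : Fin n, b j ≤ b w

/-- A (randomized) strategy profile: bidder `i` with value `v` draws her non-negative bid from
the distribution `toKernel i v`. -/
structure StrategyProfile (n : ℕ) where
  toKernel : Fin n → Kernel ℝ≥0 ℝ≥0
  isMarkov : ∀ i, IsMarkovKernel (toKernel i)

attribute [instance] TieBreakingRule.isMarkov StrategyProfile.isMarkov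

variable {n : ℕ}

/-- The law of the pairs (value, bid) of all bidders, when the values are drawn independently,
bidder `i`'s value from `V i`, and bidder `i`'s bid is then drawn from `s i` at her value. -/
def playLaw (V : Fin n → Measure ℝ≥0) (s : StrategyProfile n) :
    Measure (Fin n → ℝ≥0 × ℝ≥0) :=
  Measure.pi fun i => (V i).compProd (s.toKernel i)

/-- The bid profile of a profile of pairs (value, bid). -/
def bidProfile (x : Fin n → ℝ≥0 × ℝ≥0) : Fin n → ℝ≥0 := fun i => (x i).2

theorem measurable_bidProfile : Measurable (bidProfile (n := n)) := by
  unfold bidProfile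
  fun_prop

/-- The joint law of values, bids and allocated bidder. -/
def outcomeLaw (V : Fin n → Measure ℝ≥0) (α : TieBreakingRule n) (s : StrategyProfile n) :
    Measure ((Fin n → ℝ≥0 × ℝ≥0) × Fin n) :=
  (playLaw V s).compProd (α.toKernel.comap bidProfile measurable_bidProfile)

/-- The expected optimal social welfare: the expectation of the highest value. -/
def optimalWelfare (V : Fin n → Measure ℝ≥0) (α : TieBreakingRule n) (s : StrategyProfile n) :
    ℝ≥0∞ :=
  ∫⁻ ω, ⨆ i : Fin n, ((ω.1 i).1 : ℝ≥0∞) ∂(outcomeLaw V α s)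

/-- The expected auction social welfare: the expectation of the value of the allocated bidder. -/
def auctionWelfare (V : Fin n → Measure ℝ≥0) (α : TieBreakingRule n) (s : StrategyProfile n) :
    ℝ≥0∞ :=
  ∫⁻ ω, ((ω.1 ω.2).1 : ℝ≥0∞) ∂(outcomeLaw V α s)

/-- The probability that bidder `i` wins when she bids `b`, over the randomness of the other
bidders' values and bids and of the allocation rule. Bidder `i`'s own coordinate is overwritten
by `b`; since the values are independent, conditioning on her value has no further effect. -/
def winProb (V : Fin n → Measure ℝ≥0) (α : TieBreakingRule n) (s : StrategyProfile n)
    (i : Fin n) (b : ℝ≥0) : ℝ :=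
  (∫⁻ x, α.toKernel (Function.update (bidProfile x) i b) {i} ∂(playLaw V s)).toReal

/-- The interim utility of bidder `i` who has value `v` and bids `b`. -/
def interimUtility (V : Fin n → Measure ℝ≥0) (α : TieBreakingRule n) (s : StrategyProfile n)
    (i : Fin n) (v b : ℝ≥0) : ℝ :=
  ((v : ℝ) - (b : ℝ)) * winProb V α s i b

/-- `δ`-approximate Bayesian Nash Equilibrium for independent values: for every bidder and every
value in the support of her value distribution, following her strategy yields at least the utility
of any deviation bid, minus `δ`. As interim utilities are bounded above by the value, their
expectation always exists in `[-∞, ∞)`; integrability says that it is not `-∞`, which the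
inequality of the definition forces. -/
def IsApproxBNE (V : Fin n → Measure ℝ≥0) (α : TieBreakingRule n) (s : StrategyProfile n)
    (δ : ℝ) : Prop :=
  ∀ i : Fin n, ∀ v ∈ (V i).support,
    Integrable (fun b => interimUtility V α s i v b) (s.toKernel i v) ∧
    ∀ b' : ℝ≥0,
      ∫ b, interimUtility V α s i v b ∂(s.toKernel i v) ≥ interimUtility V α s i v b' - δ

/-- (Exact) Bayesian Nash Equilibrium. -/
def IsBNE (V : Fin n → Measure ℝ≥0) (α : TieBreakingRule n) (s : StrategyProfile n) : Prop :=
  IsApproxBNE V α s 0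

/-- The quantile function `D⁻¹(q) = inf {x | q ≤ D(x)}` of a distribution on `[0, ∞)`. It is
finite for `q < 1`; at `q = 1` it is the supremum of the support, possibly `∞`. -/
def quantile (D : Measure ℝ≥0) (q : ℝ≥0∞) : ℝ≥0∞ :=
  sInf {x : ℝ≥0∞ | q ≤ D {y : ℝ≥0 | (y : ℝ≥0∞) ≤ x}}

/-- The `ℓ_∞`-norm earth mover's distance `sup {|D⁻¹(q) - D'⁻¹(q)| : q ∈ [0, 1]}`, in `[0, ∞]`.
The absolute difference is the larger of the two truncated differences. -/
def emdInfty (D D' : Measure ℝ≥0) : ℝ≥0∞ :=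
  ⨆ q ∈ Icc (0 : ℝ≥0∞) 1,
    max (quantile D q - quantile D' q) (quantile D' q - quantile D q)

end FirstPriceAuction

end

noncomputable section

/-! In an exact equilibrium almost every bid is a best bid, and a deviation can win all ties at an
arbitrarily small extra cost. Hence (`IsBestBid.isRegularBid`) a bid below the value already wins
every tie, a bid equal to the value leaves no chance of winning at any lower bid, and a bid above
the value never wins. The equilibrium therefore dictates who should win a tie, and small raises can
enforce this under any rule: `perturb` adds `ε` to a shaded bid, `ε / 2` to a truthful bid and
nothing to an overbid or to a bid that cannot be highest.

Two shading bidders tied at the top would both have to win, so almost surely there is at most one.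
Hence every highest bidder after the raises has the value of the original winner
(`value_eq_of_isMax`), and welfare is unchanged.

The equilibrium condition concerns every value in the support, including values whose bids have
probability zero overall. At such a bid `b` the previous argument says nothing about a tie with
another shading bidder who has an atom at `b`. These are the `foreignAtoms`; raising by `2 * ε`
there beats the others, who almost surely rise by at most `ε`.

Raises only make winning harder for a deviator, so no deviation exceeds the old best utility. A
raised bid below the value still beats everyone it could beat before
(`IsBNE.othersLe_le_othersLt_perturb`), and an overbid still never wins
(`IsBNE.othersLe_perturbedProfile_eq_zero`), so at most `2 * ε` of utility is lost. -/

namespace FirstPriceAuction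

/-! ### Independent plays and bounds on winning probabilities -/

section Play

variable {n : ℕ} (V : Fin n → Measure ℝ≥0)
  (α : TieBreakingRule n) (s : StrategyProfile n) (i : Fin n)

/-- The joint law of bidder `i`'s value and bid. -/
def bidderLaw : Measure (ℝ≥0 × ℝ≥0) := (V i).compProd (s.toKernel i)

/-- The probability that all bidders other than `i` bid at most `b`. -/
def othersLe (b : ℝ≥0) : ℝ≥0∞ := playLaw V s {x | ∀ j, j ≠ i → (x j).2 ≤ b}

/-- The probability that all bidders other than `i` bid less than `b`. -/
def othersLt (b : ℝ≥0) : ℝ≥0∞ := playLaw V s {x | ∀ j, j ≠ i → (x j).2 < b}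

/-- The winning probability of bidder `i` at the bid `b`, as an extended nonnegative real. -/
def winMass (b : ℝ≥0) : ℝ≥0∞ :=
  ∫⁻ x, α.toKernel (Function.update (bidProfile x) i b) {i} ∂(playLaw V s)

theorem winProb_eq (b : ℝ≥0) : winProb V α s i b = (winMass V α s i b).toReal := rfl

theorem measurableSet_forall_ne {X : Type*} [MeasurableSpace X] {p : X → Fin n → Prop}
    (h : ∀ j, MeasurableSet {x | p x j}) : MeasurableSet {x | ∀ j, j ≠ i → p x j} := by
  have : {x | ∀ j, j ≠ i → p x j} = ⋂ j, ⋂ (_ : j ≠ i), {x | p x j} := by ext; simp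
  rw [this]
  exact MeasurableSet.iInter fun j => MeasurableSet.iInter fun _ => h j

theorem measurableSet_othersLe (b : ℝ≥0) :
    MeasurableSet {x : Fin n → ℝ≥0 × ℝ≥0 | ∀ j, j ≠ i → (x j).2 ≤ b} :=
  measurableSet_forall_ne i fun j => measurableSet_le (by fun_prop) (by fun_prop)

theorem measurableSet_othersLt (b : ℝ≥0) :
    MeasurableSet {x : Fin n → ℝ≥0 × ℝ≥0 | ∀ j, j ≠ i → (x j).2 < b} :=
  measurableSet_forall_ne i fun j => measurableSet_lt (by fun_prop) (by fun_prop)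

theorem othersLe_mono : Monotone (othersLe V s i) := fun _ _ h =>
  measure_mono fun _ hx j hj => (hx j hj).trans h

theorem othersLe_le_othersLt {b c : ℝ≥0} (h : b < c) : othersLe V s i b ≤ othersLt V s i c :=
  measure_mono fun _ hx j hj => (hx j hj).trans_lt h

theorem measurable_winKernel_update : Measurable fun p : ℝ≥0 × (Fin n → ℝ≥0 × ℝ≥0) =>
    α.toKernel (Function.update (bidProfile p.2) i p.1) {i} := by
  refine (Kernel.measurable_coe _ (measurableSet_singleton i)).comp ?_
  refine measurable_pi_lambda _ fun j => ?_
  by_cases h : j = i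
  · subst h; simpa using measurable_fst
  · simp only [Function.update_of_ne h, bidProfile]; fun_prop

theorem TieBreakingRule.apply_ne_zero {b : Fin n → ℝ≥0} {w : Fin n}
    (h : α.toKernel b {w} ≠ 0) (j : Fin n) : b j ≤ b w :=
  (ae_iff_of_countable.1 (α.firstPrice b)) w h j

theorem TieBreakingRule.exists_apply_ne_zero (b : Fin n → ℝ≥0) : ∃ w, α.toKernel b {w} ≠ 0 := by
  by_contra! h
  have : ∀ᵐ w ∂α.toKernel b, False := ae_iff_of_countable.2 fun w hw => hw (h w)
  exact this.exists.elim fun _ => id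

theorem TieBreakingRule.apply_eq_one {b : Fin n → ℝ≥0} {w : Fin n}
    (h : ∀ j, j ≠ w → b j < b w) : α.toKernel b {w} = 1 := by
  rw [← prob_compl_eq_zero_iff (measurableSet_singleton w)]
  refine measure_eq_zero_iff_ae_notMem.2 ?_
  filter_upwards [α.firstPrice b] with u hu hne
  exact absurd (hu w) (not_le.2 (h u hne))

theorem TieBreakingRule.apply_update_ne_zero {x : Fin n → ℝ≥0 × ℝ≥0} {b : ℝ≥0}
    (h : α.toKernel (Function.update (bidProfile x) i b) {i} ≠ 0) (j : Fin n) (hj : j ≠ i) :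
    (x j).2 ≤ b := by
  simpa [Function.update_of_ne hj, bidProfile] using α.apply_ne_zero h j

theorem TieBreakingRule.apply_update_le {x : Fin n → ℝ≥0 × ℝ≥0} {b : ℝ≥0} :
    α.toKernel (Function.update (bidProfile x) i b) {i} ≤
      {x : Fin n → ℝ≥0 × ℝ≥0 | ∀ j, j ≠ i → (x j).2 ≤ b}.indicator 1 x := by
  by_cases h : α.toKernel (Function.update (bidProfile x) i b) {i} = 0
  · simp [h]
  · rw [indicator_of_mem (show x ∈ {x : Fin n → ℝ≥0 × ℝ≥0 | ∀ j, j ≠ i → (x j).2 ≤ b} from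
      α.apply_update_ne_zero i h)]
    exact prob_le_one

theorem winMass_le_othersLe (b : ℝ≥0) : winMass V α s i b ≤ othersLe V s i b := by
  rw [othersLe, ← lintegral_indicator_one (measurableSet_othersLe i b)]
  exact lintegral_mono fun x => α.apply_update_le i

theorem othersLt_le_winMass (b : ℝ≥0) : othersLt V s i b ≤ winMass V α s i b := by
  rw [othersLt, ← lintegral_indicator_one (measurableSet_othersLt i b)]
  refine lintegral_mono fun x => ?_
  refine indicator_le (g := fun x => α.toKernel (Function.update (bidProfile x) i b) {i})
    (fun x hx => ?_) x
  refine (α.apply_eq_one fun j hj => ?_).ge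
  simpa [Function.update_of_ne hj, bidProfile] using hx j hj

theorem winProb_nonneg (b : ℝ≥0) : 0 ≤ winProb V α s i b := ENNReal.toReal_nonneg

theorem playLaw_eq : playLaw V s = Measure.pi (bidderLaw V s) := rfl

/-- Almost surely a bid is not below all the bids of the same bidder. -/
theorem ae_bidderLaw_le_ne_zero :
    ∀ᵐ y ∂bidderLaw V s i, bidderLaw V s i {z | z.2 ≤ y.2} ≠ 0 := by
  set m := (bidderLaw V s i).map Prod.snd
  have hm : ∀ b : ℝ≥0, m (Iic b) = bidderLaw V s i {z | z.2 ≤ b} := fun b =>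
    Measure.map_apply measurable_snd measurableSet_Iic
  have h0 : m {b | m (Iic b) = 0} = 0 := by
    -- The set is a lower set: a point below another member has a null neighbourhood, and a greatest
    -- element `b` bounds the whole set by the null set `Iic b`.
    refine measure_null_of_locally_null _ fun b hb => ?_
    by_cases h : ∃ c, m (Iic c) = 0 ∧ b < c
    · obtain ⟨c, hc, hbc⟩ := h
      exact ⟨Iic c, mem_nhdsWithin_of_mem_nhds (Iic_mem_nhds hbc), hc⟩
    · push Not at h
      exact ⟨Iic b, mem_nhdsWithin.2 ⟨univ, isOpen_univ, mem_univ _, fun c hc => h c hc.2⟩, hb⟩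
  have := ae_of_ae_map (f := Prod.snd) measurable_snd.aemeasurable
    (measure_eq_zero_iff_ae_notMem.1 h0)
  filter_upwards [this] with y hy h
  exact hy ((hm _).trans h)

variable [∀ i, IsProbabilityMeasure (V i)]

instance : IsProbabilityMeasure (bidderLaw V s i) := by
  unfold bidderLaw; infer_instance

instance : IsProbabilityMeasure (playLaw V s) := by
  rw [playLaw_eq]; infer_instance

theorem measurable_winMass : Measurable (winMass V α s i) :=
  (measurable_winKernel_update α i).lintegral_prod_right'

theorem othersLe_ne_top (b : ℝ≥0) : othersLe V s i b ≠ ∞ := measure_ne_top _ _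

theorem winMass_le_one (b : ℝ≥0) : winMass V α s i b ≤ 1 :=
  (winMass_le_othersLe V α s i b).trans prob_le_one

theorem winMass_ne_top (b : ℝ≥0) : winMass V α s i b ≠ ∞ :=
  ((winMass_le_one V α s i b).trans_lt ENNReal.one_lt_top).ne

theorem winProb_le_one (b : ℝ≥0) : winProb V α s i b ≤ 1 :=
  ENNReal.toReal_le_of_le_ofReal zero_le_one (by
    rw [ENNReal.ofReal_one]; exact winMass_le_one V α s i b)

/-- Redrawing one coordinate of a play independently does not change its law. -/
theorem map_update_prod :
    ((playLaw V s).prod (bidderLaw V s i)).map (fun p => Function.update p.1 i p.2) =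
      playLaw V s := by
  have hm : Measurable fun p : (Fin n → ℝ≥0 × ℝ≥0) × (ℝ≥0 × ℝ≥0) =>
      Function.update p.1 i p.2 := by
    refine measurable_pi_lambda _ fun j => ?_
    by_cases h : j = i
    · subst h; simpa using measurable_snd
    · simp only [Function.update_of_ne h]; fun_prop
  symm
  refine Measure.pi_eq fun t ht => ?_
  rw [Measure.map_apply hm (MeasurableSet.univ_pi ht)]
  have : (fun p : (Fin n → ℝ≥0 × ℝ≥0) × (ℝ≥0 × ℝ≥0) => Function.update p.1 i p.2) ⁻¹' univ.pi t =
      (univ.pi (Function.update t i univ)) ×ˢ (t i) := by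
    ext p
    simp only [mem_preimage, mem_univ_pi, mem_prod]
    constructor
    · intro h
      refine ⟨fun j => ?_, by simpa using h i⟩
      by_cases hj : j = i
      · subst hj; simp
      · simpa [Function.update_of_ne hj] using h j
    · rintro ⟨h, h'⟩ j
      by_cases hj : j = i
      · subst hj; simpa using h'
      · simpa [Function.update_of_ne hj] using h j
  rw [this, Measure.prod_prod, playLaw_eq, Measure.pi_pi,
    ← Finset.mul_prod_erase _ _ (Finset.mem_univ i),
    ← Finset.mul_prod_erase _ (fun j => (V j ⊗ₘ s.toKernel j) (t j)) (Finset.mem_univ i)]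
  rw [Function.update_self, measure_univ, one_mul, mul_comm]
  congr 1
  refine Finset.prod_congr rfl fun j hj => ?_
  rw [Function.update_of_ne (Finset.ne_of_mem_erase hj)]
  rfl

theorem measurable_update_prod : Measurable fun p : (ℝ≥0 × ℝ≥0) × (Fin n → ℝ≥0 × ℝ≥0) =>
    Function.update p.2 i p.1 := by
  refine measurable_pi_lambda _ fun j => ?_
  by_cases h : j = i
  · subst h; simpa using measurable_fst
  · simp only [Function.update_of_ne h]; fun_prop

theorem measurePreserving_update :
    MeasurePreserving (fun p : (ℝ≥0 × ℝ≥0) × (Fin n → ℝ≥0 × ℝ≥0) => Function.update p.2 i p.1)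
      ((bidderLaw V s i).prod (playLaw V s)) (playLaw V s) := by
  refine ⟨measurable_update_prod i, ?_⟩
  rw [← Measure.prod_swap, Measure.map_map (measurable_update_prod i) measurable_swap]
  exact map_update_prod V s i

variable {V s i} in
-- Fixing bidder `i`'s pair while the others play replaces conditioning on that pair, thanks to
-- independence.
theorem ae_update {Q : (Fin n → ℝ≥0 × ℝ≥0) → Prop} (h : ∀ᵐ x ∂playLaw V s, Q x) :
    ∀ᵐ y ∂bidderLaw V s i, ∀ᵐ x ∂playLaw V s, Q (Function.update x i y) :=
  Measure.ae_ae_of_ae_prod ((measurePreserving_update V s i).quasiMeasurePreserving.ae h)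

variable {V s i} in
theorem ae_of_ae_update {Q : (Fin n → ℝ≥0 × ℝ≥0) → Prop} (hQ : MeasurableSet {x | Q x})
    (h : ∀ᵐ y ∂bidderLaw V s i, ∀ᵐ x ∂playLaw V s, Q (Function.update x i y)) :
    ∀ᵐ x ∂playLaw V s, Q x := by
  rw [← (measurePreserving_update V s i).map_eq,
    ae_map_iff (measurable_update_prod i).aemeasurable hQ]
  exact (Measure.ae_prod_iff_ae_ae (hQ.preimage (measurable_update_prod i))).2 h

variable {V s i} in
/-- An event of the other bidders that is almost surely incompatible with an event of positive
probability of bidder `i` is null. -/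
theorem ae_not_of_indep {A : (Fin n → ℝ≥0 × ℝ≥0) → Prop} {S : Set (ℝ≥0 × ℝ≥0)}
    (hA : ∀ x y, A (Function.update x i y) ↔ A x) (hS : bidderLaw V s i S ≠ 0)
    (h : ∀ᵐ x ∂playLaw V s, x i ∈ S → ¬ A x) : ∀ᵐ x ∂playLaw V s, ¬ A x := by
  obtain ⟨y, hyS, hy⟩ := ((frequently_ae_mem_iff.2 hS).and_eventually (ae_update (i := i) h)).exists
  filter_upwards [hy] with x hx
  simpa [hA, hyS] using hx

variable {V s} in
theorem ae_eval {Q : ℝ≥0 × ℝ≥0 → Prop} (h : ∀ᵐ y ∂bidderLaw V s i, Q y) :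
    ∀ᵐ x ∂playLaw V s, Q (x i) :=
  (measurePreserving_eval (bidderLaw V s) i).quasiMeasurePreserving.ae h

variable {V s i} in
/-- If every bidder other than `i`, and also `i` herself, has a chance to bid at most `b`, then so
has every set of bidders jointly. -/
theorem othersLe_ne_zero {b : ℝ≥0} (h : othersLe V s i b ≠ 0)
    (hi : bidderLaw V s i {y | y.2 ≤ b} ≠ 0) (k : Fin n) : othersLe V s k b ≠ 0 := by
  intro hk
  have h0 : ∀ᵐ x ∂playLaw V s, ¬ ∀ j, j ≠ k → (x j).2 ≤ b := measure_eq_zero_iff_ae_notMem.1 hk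
  refine h (measure_eq_zero_iff_ae_notMem.2 ?_)
  refine ae_not_of_indep (i := i) (S := {y | y.2 ≤ b}) (fun x y => ?_) hi ?_
  · exact forall_congr' fun j => forall_congr' fun hj => by rw [Function.update_of_ne hj]
  · filter_upwards [h0] with x hx hxi hA
    refine hx fun j _ => ?_
    by_cases hj : j = i
    · subst hj; exact hxi
    · exact hA j hj

/-- Almost surely a bidder who bids highest had a chance to be highest at her bid. -/
theorem ae_othersLe_ne_zero :
    ∀ᵐ x ∂playLaw V s, (∀ j, j ≠ i → (x j).2 ≤ (x i).2) → othersLe V s i (x i).2 ≠ 0 := by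
  refine ae_of_ae_update (i := i) ?_ (ae_of_all _ fun y => ?_)
  · refine MeasurableSet.imp
      (measurableSet_forall_ne i fun j => measurableSet_le (by fun_prop) (by fun_prop)) ?_
    exact ((othersLe_mono V s i).measurable.comp (by fun_prop : Measurable
      fun x : Fin n → ℝ≥0 × ℝ≥0 => (x i).2)) (measurableSet_singleton 0).compl
  · by_cases h : othersLe V s i y.2 = 0
    · filter_upwards [measure_eq_zero_iff_ae_notMem.1 h] with x hx hall
      refine absurd (fun j hj => ?_) hx
      simpa [Function.update_of_ne hj] using hall j hj
    · exact ae_of_all _ fun x _ => by simpa using h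

end Play

/-! ### Best bids in an exact equilibrium -/

section BestBid

variable {n : ℕ} (V : Fin n → Measure ℝ≥0)
  (α : TieBreakingRule n) (s : StrategyProfile n) (i : Fin n)

/-- The best utility of bidder `i` is attained by `b` at the value `v`. -/
def IsBestBid (v b : ℝ≥0) : Prop :=
  ∀ b', interimUtility V α s i v b' ≤ interimUtility V α s i v b

/-- The consequences of being a best bid that are used to compare winners: winning all ties above
the bid, no chance below the bid when it equals the value, and never winning below the bid. -/
def IsRegularBid (y : ℝ≥0 × ℝ≥0) : Prop :=
  (y.2 < y.1 → winMass V α s i y.2 = othersLe V s i y.2) ∧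
  (y.2 = y.1 → ∀ c < y.2, othersLe V s i c = 0) ∧ (y.1 < y.2 → winMass V α s i y.2 = 0)

variable {V α s i}

theorem IsBestBid.utility_nonneg {v b : ℝ≥0} (h : IsBestBid V α s i v b) :
    0 ≤ interimUtility V α s i v b := by
  simpa [interimUtility] using h v

/-- With `δ = 0` the mean utility bounds the utility of every bid, and a variable bounded by its own
mean equals it almost surely. -/
theorem IsBNE.ae_isBestBid (hs : IsBNE V α s) {v : ℝ≥0} (hv : v ∈ (V i).support) :
    ∀ᵐ b ∂s.toKernel i v, IsBestBid V α s i v b := by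
  obtain ⟨hint, hopt⟩ := hs i v hv
  set U := ∫ b, interimUtility V α s i v b ∂(s.toKernel i v) with hU
  have hle : ∀ b, interimUtility V α s i v b ≤ U := fun b => by simpa using hopt b
  have h0 : ∫ b, (U - interimUtility V α s i v b) ∂(s.toKernel i v) = 0 := by
    rw [integral_sub (integrable_const _) hint]; simp [hU]
  have := (integral_eq_zero_iff_of_nonneg (fun b => sub_nonneg.2 (hle b))
    ((integrable_const _).sub hint)).1 h0
  filter_upwards [this] with b hb b'
  have : U = interimUtility V α s i v b := sub_eq_zero.1 hb
  exact this ▸ hle b'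

theorem ae_winKernel_eq_zero {b : ℝ≥0} (h : winMass V α s i b = 0) :
    ∀ᵐ x ∂playLaw V s, α.toKernel (Function.update (bidProfile x) i b) {i} = 0 :=
  (lintegral_eq_zero_iff ((measurable_winKernel_update α i).comp measurable_prodMk_left)).1 h

variable [∀ i, IsProbabilityMeasure (V i)]

theorem IsBestBid.mul_othersLt_le {v b b' : ℝ≥0} (h : IsBestBid V α s i v b) (hb' : b' ≤ v) :
    ((v : ℝ) - b') * (othersLt V s i b').toReal ≤ interimUtility V α s i v b := by
  refine le_trans ?_ (h b')
  refine mul_le_mul_of_nonneg_left ?_ (sub_nonneg.2 hb')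
  exact ENNReal.toReal_mono (winMass_ne_top V α s i b') (othersLt_le_winMass V α s i b')

/-- A deviation cannot gain even if all ties are broken in its favour. -/
theorem IsBestBid.mul_othersLe_le {v b b' : ℝ≥0} (h : IsBestBid V α s i v b) (hb' : b' ≤ v) :
    ((v : ℝ) - b') * (othersLe V s i b').toReal ≤ interimUtility V α s i v b := by
  rcases hb'.eq_or_lt with rfl | hlt
  · simpa using h.utility_nonneg
  have hlt' : (b' : ℝ) < v := hlt
  -- A bid `c` slightly above `b'` beats everyone bidding at most `b'`; then let `c` decrease to
  -- `b'`.
  have key : ∀ c ∈ Ioo (b' : ℝ) v,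
      ((v : ℝ) - c) * (othersLe V s i b').toReal ≤ interimUtility V α s i v b := by
    rintro c ⟨hc, hcv⟩
    lift c to ℝ≥0 using b'.2.trans hc.le
    refine le_trans ?_ (h.mul_othersLt_le (b' := c) (by exact_mod_cast hcv.le))
    refine mul_le_mul_of_nonneg_left ?_ (sub_nonneg.2 hcv.le)
    exact ENNReal.toReal_mono (measure_ne_top _ _)
      (othersLe_le_othersLt V s i (by exact_mod_cast hc))
  have hc : ContinuousWithinAt (fun c : ℝ => ((v : ℝ) - c) * (othersLe V s i b').toReal)
      (Ioo (b' : ℝ) v) b' := by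
    apply Continuous.continuousWithinAt; fun_prop
  have hne : (nhdsWithin (b' : ℝ) (Ioo (b' : ℝ) v)).NeBot := by
    rw [← mem_closure_iff_nhdsWithin_neBot, closure_Ioo hlt'.ne]
    exact left_mem_Icc.2 hlt'.le
  exact le_of_tendsto hc (Filter.eventually_of_mem self_mem_nhdsWithin key)

/-- Below the value, losing a tie with positive probability would be improved by a tiny raise. At
the value the utility is zero, so a lower bid with a chance would be profitable. Above it, winning
would give negative utility, whereas bidding the value gives zero. -/
theorem IsBestBid.isRegularBid {v b : ℝ≥0} (h : IsBestBid V α s i v b) :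
    IsRegularBid V α s i (v, b) := by
  refine ⟨fun hlt => ?_, fun heq => ?_, fun hlt => ?_⟩
  · have hlt' : (b : ℝ) < v := hlt
    have h1 := h.mul_othersLe_le hlt.le
    refine le_antisymm (winMass_le_othersLe V α s i b) ?_
    change othersLe V s i b ≤ winMass V α s i b
    rw [← ENNReal.toReal_le_toReal (othersLe_ne_top V s i b) (winMass_ne_top V α s i b)]
    exact le_of_mul_le_mul_left h1 (sub_pos.2 hlt')
  · change b = v at heq
    subst heq
    intro c hc
    change c < b at hc
    have h1 := h.mul_othersLe_le hc.le
    have hc' : (c : ℝ) < b := hc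
    rw [interimUtility, sub_self, zero_mul] at h1
    have h2 : (othersLe V s i c).toReal ≤ 0 := by
      by_contra h3
      exact absurd h1 (not_le.2 (mul_pos (sub_pos.2 hc') (not_le.1 h3)))
    exact ((ENNReal.toReal_eq_zero_iff _).1 (le_antisymm h2 ENNReal.toReal_nonneg)).resolve_right
      (measure_ne_top _ _)
  · have hlt' : (v : ℝ) < b := hlt
    by_contra h0
    have hpos : 0 < winProb V α s i b := ENNReal.toReal_pos h0 (winMass_ne_top V α s i b)
    exact absurd h.utility_nonneg (not_le.2 (mul_neg_of_neg_of_pos (sub_neg.2 hlt') hpos))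

variable (V α s i) in
theorem measurableSet_isRegularBid : MeasurableSet {y | IsRegularBid V α s i y} := by
  have hX : Measurable fun y : ℝ≥0 × ℝ≥0 => winMass V α s i y.2 :=
    (measurable_winMass V α s i).comp measurable_snd
  have hF : Measurable fun y : ℝ≥0 × ℝ≥0 => othersLe V s i y.2 :=
    (othersLe_mono V s i).measurable.comp measurable_snd
  have hc : MeasurableSet {b : ℝ≥0 | ∀ c < b, othersLe V s i c = 0} :=
    OrdConnected.measurableSet ⟨fun _ _ _ hb _ hd c hc => hb c (hc.trans_le hd.2)⟩
  refine MeasurableSet.inter (.imp (measurableSet_lt measurable_snd measurable_fst)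
    (measurableSet_eq_fun hX hF)) (.inter (.imp (measurableSet_eq_fun measurable_snd measurable_fst)
      (measurable_snd hc)) (.imp (measurableSet_lt measurable_fst measurable_snd)
        (hX (measurableSet_singleton 0))))

variable (i) in
theorem IsBNE.ae_isRegularBid (hs : IsBNE V α s) :
    ∀ᵐ y ∂bidderLaw V s i, IsRegularBid V α s i y := by
  refine Measure.ae_compProd_of_ae_ae (measurableSet_isRegularBid V α s i) ?_
  filter_upwards [Measure.support_mem_ae] with v hv
  filter_upwards [hs.ae_isBestBid hv] with b hb using hb.isRegularBid

theorem update_bidProfile_self (x : Fin n → ℝ≥0 × ℝ≥0) :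
    Function.update (bidProfile x) i (x i).2 = bidProfile x :=
  Function.update_eq_self i (bidProfile x)

theorem bidProfile_update (x : Fin n → ℝ≥0 × ℝ≥0) (y : ℝ≥0 × ℝ≥0) :
    bidProfile (Function.update x i y) = Function.update (bidProfile x) i y.2 := by
  ext j
  by_cases hj : j = i
  · subst hj; simp [bidProfile]
  · simp [bidProfile, Function.update_of_ne hj]

variable (α i) in
theorem measurable_winKernel : Measurable fun x : Fin n → ℝ≥0 × ℝ≥0 =>
    α.toKernel (bidProfile x) {i} :=
  (Kernel.measurable_coe _ (measurableSet_singleton i)).comp measurable_bidProfile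

/-- The winning probability is pointwise at most the indicator of being highest; equal finite
integrals force almost sure equality. -/
theorem ae_winKernel_eq_one {b : ℝ≥0} (h : winMass V α s i b = othersLe V s i b) :
    ∀ᵐ x ∂playLaw V s, (∀ j, j ≠ i → (x j).2 ≤ b) →
      α.toKernel (Function.update (bidProfile x) i b) {i} = 1 := by
  have := ae_eq_of_ae_le_of_lintegral_le (μ := playLaw V s)
    (f := fun x => α.toKernel (Function.update (bidProfile x) i b) {i})
    (g := {x : Fin n → ℝ≥0 × ℝ≥0 | ∀ j, j ≠ i → (x j).2 ≤ b}.indicator 1)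
    (ae_of_all _ fun x => α.apply_update_le i) (winMass_ne_top V α s i b)
    ((measurable_one.indicator (measurableSet_othersLe i b)).aemeasurable)
    (by rw [lintegral_indicator_one (measurableSet_othersLe i b)]; exact h.ge)
  filter_upwards [this] with x hx hall
  rw [hx, indicator_of_mem (show x ∈ {x : Fin n → ℝ≥0 × ℝ≥0 | ∀ j, j ≠ i → (x j).2 ≤ b} from hall)]
  rfl

variable (i) in
/-- Almost surely a bidder who bids above her value does not win. -/
theorem IsBNE.ae_winKernel_eq_zero (hs : IsBNE V α s) :
    ∀ᵐ x ∂playLaw V s, (x i).1 < (x i).2 → α.toKernel (bidProfile x) {i} = 0 := by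
  refine ae_of_ae_update (i := i) ?_ ?_
  · exact .imp (measurableSet_lt (by fun_prop) (by fun_prop))
      (measurable_winKernel α i (measurableSet_singleton 0))
  · filter_upwards [hs.ae_isRegularBid i] with y hy
    by_cases hlt : y.1 < y.2
    · filter_upwards [FirstPriceAuction.ae_winKernel_eq_zero (hy.2.2 hlt)] with x hx _
      rwa [bidProfile_update]
    · exact ae_of_all _ fun x h => absurd (by simpa using h) hlt

variable (i) in
/-- Almost surely a highest bidder who bids below her value wins. -/
theorem IsBNE.ae_winKernel_eq_one (hs : IsBNE V α s) :
    ∀ᵐ x ∂playLaw V s, (x i).2 < (x i).1 → (∀ j, j ≠ i → (x j).2 ≤ (x i).2) →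
      α.toKernel (bidProfile x) {i} = 1 := by
  refine ae_of_ae_update (i := i) ?_ ?_
  · exact .imp (measurableSet_lt (by fun_prop) (by fun_prop)) (.imp (measurableSet_forall_ne i
      fun j => measurableSet_le (by fun_prop) (by fun_prop))
      (measurable_winKernel α i (measurableSet_singleton 1)))
  · filter_upwards [hs.ae_isRegularBid i] with y hy
    by_cases hlt : y.2 < y.1
    · filter_upwards [FirstPriceAuction.ae_winKernel_eq_one (hy.1 hlt)] with x hx _ hall
      rw [bidProfile_update]
      exact hx fun j hj => by simpa [Function.update_of_ne hj] using hall j hj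
    · exact ae_of_all _ fun x h => absurd (by simpa using h) hlt

end BestBid

/-! ### The perturbed bids and their laws -/

section Perturbation

variable {n : ℕ} (V : Fin n → Measure ℝ≥0)
  (s : StrategyProfile n) (ε : ℝ≥0) (i : Fin n)

/-- The bids that bidder `i` makes with probability zero, but some bidder with positive
probability. -/
def foreignAtoms : Set ℝ≥0 :=
  {b | bidderLaw V s i {y | y.2 = b} = 0 ∧ ∃ j, bidderLaw V s j {y | y.2 = b} ≠ 0}

open Classical in
/-- The perturbed bid: bids with a chance to win are raised in such a way that bidders who shade
their bids beat, at equal bids, those who bid their value, and the latter beat those who overbid. -/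
def perturb (y : ℝ≥0 × ℝ≥0) : ℝ≥0 :=
  if othersLe V s i y.2 = 0 then y.2
  else if y.2 < y.1 then (if y.2 ∈ foreignAtoms V s i then y.2 + 2 * ε else y.2 + ε)
  else if y.2 = y.1 then y.2 + ε / 2
  else y.2

variable {V s ε i}

theorem le_perturb (y : ℝ≥0 × ℝ≥0) : y.2 ≤ perturb V s ε i y := by
  unfold perturb; split_ifs <;> simp

theorem perturb_le (y : ℝ≥0 × ℝ≥0) : perturb V s ε i y ≤ y.2 + 2 * ε := by
  have h1 : ε ≤ 2 * ε := le_mul_of_one_le_left' (by norm_num)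
  have h2 : ε / 2 ≤ 2 * ε := (NNReal.half_le_self ε).trans h1
  unfold perturb; split_ifs <;> simp [h1, h2]

theorem perturb_le_of_notMem {y : ℝ≥0 × ℝ≥0} (h : y.2 ∉ foreignAtoms V s i) :
    perturb V s ε i y ≤ y.2 + ε := by
  have h2 : ε / 2 ≤ ε := NNReal.half_le_self ε
  unfold perturb; split_ifs <;> simp [h2]

theorem le_perturb_of_lt {y : ℝ≥0 × ℝ≥0} (h0 : othersLe V s i y.2 ≠ 0) (h : y.2 < y.1) :
    y.2 + ε ≤ perturb V s ε i y := by
  have h1 : ε ≤ 2 * ε := le_mul_of_one_le_left' (by norm_num)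
  unfold perturb; rw [if_neg h0, if_pos h]; split_ifs <;> simp [h1]

theorem perturb_of_eq {y : ℝ≥0 × ℝ≥0} (h0 : othersLe V s i y.2 ≠ 0) (h : y.2 = y.1) :
    perturb V s ε i y = y.2 + ε / 2 := by
  unfold perturb; rw [if_neg h0, if_neg h.not_lt, if_pos h]

theorem perturb_of_lt {y : ℝ≥0 × ℝ≥0} (h : y.1 < y.2) : perturb V s ε i y = y.2 := by
  unfold perturb; rw [if_neg h.not_gt, if_neg h.ne']; simp

theorem perturb_of_othersLe_eq_zero {y : ℝ≥0 × ℝ≥0} (h : othersLe V s i y.2 = 0) :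
    perturb V s ε i y = y.2 := by
  unfold perturb; rw [if_pos h]

/-- The size of the raise reveals shading: truthful bids gain at most `ε / 2`. -/
theorem lt_of_lt_perturb {y : ℝ≥0 × ℝ≥0} (hN : y.2 ∉ foreignAtoms V s i)
    (h : y.2 + ε / 2 < perturb V s ε i y) : y.2 < y.1 := by
  by_contra hlt
  unfold perturb at h
  split_ifs at h <;> simp_all

theorem lt_perturb_of_le (hε : 0 < ε) {y : ℝ≥0 × ℝ≥0} (h0 : othersLe V s i y.2 ≠ 0)
    (h : y.2 ≤ y.1) : y.2 < perturb V s ε i y := by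
  rcases h.lt_or_eq with h | h
  · exact (lt_add_of_pos_right _ hε).trans_le (le_perturb_of_lt h0 h)
  · rw [perturb_of_eq h0 h]; exact lt_add_of_pos_right _ (half_pos hε)

theorem countable_foreignAtoms [∀ i, IsProbabilityMeasure (V i)] :
    (foreignAtoms V s i).Countable := by
  refine (countable_iUnion fun j => Measure.countable_meas_pos_of_disjoint_iUnion
    (μ := bidderLaw V s j) (As := fun b : ℝ≥0 => {y | y.2 = b})
    (fun b => measurable_snd (measurableSet_singleton b)) fun b c hbc => ?_).mono ?_
  · exact disjoint_left.2 fun y hy hy' => hbc (hy.symm.trans hy')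
  · rintro b ⟨-, j, hj⟩
    exact mem_iUnion.2 ⟨j, pos_iff_ne_zero.2 hj⟩

variable [∀ i, IsProbabilityMeasure (V i)]

variable (V s i) in
-- These are countably many bids, each null for bidder `i`. So in actual play raises almost surely
-- stay within `ε`.
theorem ae_notMem_foreignAtoms : ∀ᵐ y ∂bidderLaw V s i, y.2 ∉ foreignAtoms V s i := by
  refine measure_eq_zero_iff_ae_notMem (s := {y : ℝ≥0 × ℝ≥0 | y.2 ∈ foreignAtoms V s i}).1 ?_
  have : {y : ℝ≥0 × ℝ≥0 | y.2 ∈ foreignAtoms V s i} = ⋃ b ∈ foreignAtoms V s i, {y | y.2 = b} := by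
    ext y; simp
  rw [this, measure_biUnion_null_iff countable_foreignAtoms]
  exact fun b hb => hb.1

variable (V s ε i) in
theorem measurable_perturb : Measurable (perturb V s ε i) := by
  unfold perturb
  have hF : Measurable fun y : ℝ≥0 × ℝ≥0 => othersLe V s i y.2 :=
    (othersLe_mono V s i).measurable.comp measurable_snd
  refine .ite (hF (measurableSet_singleton 0)) (by fun_prop) (.ite
    (measurableSet_lt measurable_snd measurable_fst) (.ite
      (measurable_snd countable_foreignAtoms.measurableSet) (by fun_prop) (by fun_prop)) (.ite
        (measurableSet_eq_fun measurable_snd measurable_fst) (by fun_prop) (by fun_prop)))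

variable (V s ε) in
/-- The strategy profile of the perturbed bids. -/
def perturbedProfile : StrategyProfile n where
  toKernel i := (Kernel.id ×ₖ s.toKernel i).map (perturb V s ε i)
  isMarkov i := Kernel.IsMarkovKernel.map _ (measurable_perturb V s ε i)

theorem perturbedProfile_apply (v : ℝ≥0) : (perturbedProfile V s ε).toKernel i v =
    (s.toKernel i v).map fun b => perturb V s ε i (v, b) := by
  change (Kernel.id ×ₖ s.toKernel i).map (perturb V s ε i) v = _
  rw [Kernel.map_apply _ (measurable_perturb V s ε i), Kernel.prod_apply, Kernel.id_apply,
    Measure.dirac_prod, Measure.map_map (measurable_perturb V s ε i) measurable_prodMk_left]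
  rfl

variable (V s ε) in
/-- The profile of values and perturbed bids. -/
def perturbPlay (x : Fin n → ℝ≥0 × ℝ≥0) : Fin n → ℝ≥0 × ℝ≥0 :=
  fun i => ((x i).1, perturb V s ε i (x i))

variable (V s ε) in
theorem measurable_perturbPlay : Measurable (perturbPlay V s ε) :=
  measurable_pi_lambda _ fun i => by
    have := measurable_perturb V s ε i
    unfold perturbPlay; fun_prop

theorem bidderLaw_perturbedProfile : bidderLaw V (perturbedProfile V s ε) i =
    (bidderLaw V s i).map fun y => (y.1, perturb V s ε i y) := by
  have hm : Measurable fun y : ℝ≥0 × ℝ≥0 => (y.1, perturb V s ε i y) :=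
    measurable_fst.prodMk (measurable_perturb V s ε i)
  ext A hA
  rw [Measure.map_apply hm hA, bidderLaw, bidderLaw, Measure.compProd_apply hA,
    Measure.compProd_apply (hm hA)]
  refine lintegral_congr fun v => ?_
  rw [perturbedProfile_apply]
  exact Measure.map_apply ((measurable_perturb V s ε i).comp measurable_prodMk_left)
    (measurable_prodMk_left hA)

variable (V s ε) in
-- The perturbation acts coordinatewise, so the new play is the image of the old one and both can be
-- compared on the same sample space.
theorem playLaw_perturbedProfile :
    playLaw V (perturbedProfile V s ε) = (playLaw V s).map (perturbPlay V s ε) := by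
  have hm : ∀ i, Measurable fun y : ℝ≥0 × ℝ≥0 => (y.1, perturb V s ε i y) := fun i =>
    measurable_fst.prodMk (measurable_perturb V s ε i)
  have hσ (i : Fin n) : SigmaFinite ((bidderLaw V s i).map fun y => (y.1, perturb V s ε i y)) :=
    have := Measure.isProbabilityMeasure_map (μ := bidderLaw V s i) (hm i).aemeasurable
    IsFiniteMeasure.toSigmaFinite _
  have key := Measure.pi_map_pi (hμ := hσ) fun i => (hm i).aemeasurable
  exact (congrArg Measure.pi (funext fun i => bidderLaw_perturbedProfile)).trans key.symm

/-! ### Invariance of welfare -/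

section Welfare

variable {α : TieBreakingRule n}

/-- A play at which the winner under `α` has the same value as every highest bidder after the
perturbation. -/
theorem value_eq_of_isMax (hε : 0 < ε) {x : Fin n → ℝ≥0 × ℝ≥0}
    (h_over : ∀ i, (x i).1 < (x i).2 → α.toKernel (bidProfile x) {i} = 0)
    (h_under : ∀ i, (x i).2 < (x i).1 → (∀ j, j ≠ i → (x j).2 ≤ (x i).2) →
      α.toKernel (bidProfile x) {i} = 1)
    (h_top : ∀ i, (∀ j, j ≠ i → (x j).2 ≤ (x i).2) → othersLe V s i (x i).2 ≠ 0)
    (h_atom : ∀ i, (x i).2 ∉ foreignAtoms V s i)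
    (h_self : ∀ i, bidderLaw V s i {z | z.2 ≤ (x i).2} ≠ 0)
    (h_eq : ∀ i, (x i).2 = (x i).1 → ∀ c < (x i).2, othersLe V s i c = 0)
    {w u : Fin n} (hw : α.toKernel (bidProfile x) {w} ≠ 0)
    (hu : ∀ j, perturb V s ε j (x j) ≤ perturb V s ε u (x u)) : (x w).1 = (x u).1 := by
  have hmax : ∀ j, (x j).2 ≤ (x w).2 := α.apply_ne_zero hw
  -- A shading highest bidder wins with probability one, which excludes every other winner.
  have huniq : ∀ k, (x k).2 = (x w).2 → (x k).2 < (x k).1 → k = w := by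
    intro k hk hlt
    by_contra hne
    have h1 := h_under k hlt fun j _ => hk ▸ hmax j
    have h2 : α.toKernel (bidProfile x) {w} ≤ 0 := by
      rw [← (prob_compl_eq_zero_iff (measurableSet_singleton k)).2 h1]
      exact measure_mono fun z hz => by
        rw [mem_singleton_iff] at hz; subst hz; exact fun h => hne h.symm
    exact hw (nonpos_iff_eq_zero.1 h2)
  have hF := h_top w fun j _ => hmax j
  have hle : (x w).2 ≤ (x w).1 := not_lt.1 fun h => hw (h_over w h)
  rcases hle.lt_or_eq with hlt | heq
  · have h1 : (x w).2 + ε ≤ (x u).2 + ε :=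
      ((le_perturb_of_lt hF hlt).trans (hu w)).trans (perturb_le_of_notMem (h_atom u))
    have h2 : (x u).2 = (x w).2 := le_antisymm (hmax u) (le_of_add_le_add_right h1)
    have h3 : (x u).2 < (x u).1 := by
      refine lt_of_lt_perturb (h_atom u) (lt_of_lt_of_le ?_ ((le_perturb_of_lt hF hlt).trans (hu w)))
      rw [h2]
      exact add_lt_add_right (NNReal.half_lt_self hε.ne') _
    rw [huniq u h2 h3]
  · have h1 : (x w).2 + ε / 2 ≤ perturb V s ε u (x u) := by
      rw [← perturb_of_eq hF heq]; exact hu w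
    have hε2 : 0 < ε / 2 := half_pos hε
    have h2 : (x u).2 < perturb V s ε u (x u) :=
      (hmax u).trans_lt ((lt_add_of_pos_right _ hε2).trans_le h1)
    have hFu : othersLe V s u (x u).2 ≠ 0 := fun h =>
      h2.ne (perturb_of_othersLe_eq_zero h).symm
    have hvu : (x u).2 ≤ (x u).1 := not_lt.1 fun h => h2.ne (perturb_of_lt h).symm
    have h3 : (x u).2 = (x w).2 := by
      refine (hmax u).eq_of_not_lt fun h => ?_
      -- If `u` had bid less, everyone could jointly bid at most that amount, giving the truthful
      -- `w` a chance below her value.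
      exact othersLe_ne_zero hFu (h_self u) w (h_eq w heq _ h)
    rcases hvu.lt_or_eq with h | h
    · rw [huniq u h3 h]
    · rw [← heq, ← h, h3]

theorem optimalWelfare_eq (V : Fin n → Measure ℝ≥0) [∀ i, IsProbabilityMeasure (V i)]
    (α : TieBreakingRule n) (s : StrategyProfile n) :
    optimalWelfare V α s = ∫⁻ x, ⨆ i : Fin n, ((x i).1 : ℝ≥0∞) ∂playLaw V s := by
  rw [optimalWelfare, outcomeLaw, Measure.lintegral_compProd (by fun_prop)]
  simp

theorem auctionWelfare_eq (V : Fin n → Measure ℝ≥0) [∀ i, IsProbabilityMeasure (V i)]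
    (α : TieBreakingRule n) (s : StrategyProfile n) :
    auctionWelfare V α s =
      ∫⁻ x, ∫⁻ w, ((x w).1 : ℝ≥0∞) ∂α.toKernel (bidProfile x) ∂playLaw V s := by
  rw [auctionWelfare, outcomeLaw, Measure.lintegral_compProd]
  · rfl
  · refine measurable_from_prod_countable_left fun w => ?_
    fun_prop

theorem measurable_lintegral_value (α : TieBreakingRule n) : Measurable
    fun x : Fin n → ℝ≥0 × ℝ≥0 => ∫⁻ w, ((x w).1 : ℝ≥0∞) ∂α.toKernel (bidProfile x) := by
  have : Measurable fun p : (Fin n → ℝ≥0 × ℝ≥0) × Fin n => ((p.1 p.2).1 : ℝ≥0∞) :=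
    measurable_from_prod_countable_left fun w => by fun_prop
  exact Measurable.lintegral_kernel_prod_right
    (κ := α.toKernel.comap bidProfile measurable_bidProfile)
    (f := fun x w => ((x w).1 : ℝ≥0∞)) this

theorem optimalWelfare_perturbedProfile (α' : TieBreakingRule n) :
    optimalWelfare V α' (perturbedProfile V s ε) = optimalWelfare V α s := by
  rw [optimalWelfare_eq, optimalWelfare_eq, playLaw_perturbedProfile,
    lintegral_map (by fun_prop) (measurable_perturbPlay V s ε)]
  rfl

/-- On almost every play all possible winners, under `α` before the raises and under `α'` after
them, share one value, so the two inner integrals agree pointwise. -/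
theorem IsBNE.auctionWelfare_perturbedProfile (hs : IsBNE V α s) (hε : 0 < ε)
    (α' : TieBreakingRule n) :
    auctionWelfare V α' (perturbedProfile V s ε) = auctionWelfare V α s := by
  rw [auctionWelfare_eq, auctionWelfare_eq, playLaw_perturbedProfile,
    lintegral_map (measurable_lintegral_value α') (measurable_perturbPlay V s ε)]
  refine lintegral_congr_ae ?_
  filter_upwards [ae_all_iff.2 fun i => hs.ae_winKernel_eq_zero i,
    ae_all_iff.2 fun i => hs.ae_winKernel_eq_one i,
    ae_all_iff.2 fun i => ae_othersLe_ne_zero V s i,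
    ae_all_iff.2 fun i => ae_eval i (ae_notMem_foreignAtoms V s i),
    ae_all_iff.2 fun i => ae_eval i (ae_bidderLaw_le_ne_zero V s i),
    ae_all_iff.2 fun i => ae_eval i (hs.ae_isRegularBid i)] with x h1 h2 h3 h4 h5 h6
  have key := fun {w u} => value_eq_of_isMax (α := α) hε h1 h2 h3 h4 h5 (fun i => (h6 i).2.1)
    (w := w) (u := u)
  obtain ⟨w₀, hw₀⟩ := α.exists_apply_ne_zero (bidProfile x)
  obtain ⟨u₀, hu₀⟩ : ∃ u, ∀ j, perturb V s ε j (x j) ≤ perturb V s ε u (x u) :=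
    (α'.firstPrice (bidProfile (perturbPlay V s ε x))).exists
  have e1 : ∫⁻ w, ((x w).1 : ℝ≥0∞) ∂α.toKernel (bidProfile x) = ((x u₀).1 : ℝ≥0∞) := by
    rw [lintegral_congr_ae (g := fun _ => ((x u₀).1 : ℝ≥0∞))
      (ae_iff_of_countable.2 fun w hw => by rw [key hw hu₀])]
    simp
  have e2 : ∫⁻ w, ((perturbPlay V s ε x w).1 : ℝ≥0∞)
      ∂α'.toKernel (bidProfile (perturbPlay V s ε x)) = ((x w₀).1 : ℝ≥0∞) := by
    rw [lintegral_congr_ae (g := fun _ => ((x w₀).1 : ℝ≥0∞))]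
    · simp
    · filter_upwards [α'.firstPrice (bidProfile (perturbPlay V s ε x))] with u hu
      rw [key hw₀ hu]; rfl
  rw [e1, e2, key hw₀ hu₀]

end Welfare

/-! ### Closeness of quantiles -/

section Quantile

/-- The quantiles of the perturbed bid distribution are within `2 * ε`. -/
theorem emdInfty_map_le {D : Measure ℝ≥0} {f : ℝ≥0 → ℝ≥0} (hf : Measurable f) {η : ℝ≥0}
    (h1 : ∀ b, b ≤ f b) (h2 : ∀ b, f b ≤ b + η) : emdInfty D (D.map f) ≤ η := by
  have hm : ∀ x : ℝ≥0∞, MeasurableSet {y : ℝ≥0 | (y : ℝ≥0∞) ≤ x} := fun x =>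
    measurableSet_le (by fun_prop) (by fun_prop)
  have e : ∀ x : ℝ≥0∞, D.map f {y : ℝ≥0 | (y : ℝ≥0∞) ≤ x} = D {y : ℝ≥0 | (f y : ℝ≥0∞) ≤ x} :=
    fun x => Measure.map_apply hf (hm x)
  refine iSup₂_le fun q _ => max_le ?_ ?_
  · rw [tsub_eq_zero_of_le]
    · exact zero_le
    · refine le_sInf fun x hx => sInf_le ?_
      refine le_trans (show q ≤ _ from hx) ((e x).trans_le (measure_mono fun y hy => ?_))
      exact le_trans (by exact_mod_cast h1 y) (show (f y : ℝ≥0∞) ≤ x from hy)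
  · rw [tsub_le_iff_right, add_comm, quantile, quantile, ENNReal.sInf_add]
    refine le_iInf₂ fun x hx => sInf_le ?_
    refine le_trans (show q ≤ _ from hx) (le_trans (measure_mono fun y hy => ?_) (e (x + η)).ge)
    change (f y : ℝ≥0∞) ≤ x + η
    calc (f y : ℝ≥0∞) ≤ (y + η : ℝ≥0) := by exact_mod_cast h2 y
      _ = (y : ℝ≥0∞) + η := by push_cast; rfl
      _ ≤ x + η := by gcongr; exact hy

end Quantile

end Perturbation

/-! ### Approximate equilibrium under every tie-breaking rule -/

section Equilibrium

variable {n : ℕ} {V : Fin n → Measure ℝ≥0} [∀ i, IsProbabilityMeasure (V i)]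
  {α α' : TieBreakingRule n} {s : StrategyProfile n} {ε : ℝ≥0} {i : Fin n}

theorem othersLe_perturbedProfile (c : ℝ≥0) : othersLe V (perturbedProfile V s ε) i c =
    playLaw V s {x | ∀ j, j ≠ i → perturb V s ε j (x j) ≤ c} := by
  rw [othersLe, playLaw_perturbedProfile,
    Measure.map_apply (measurable_perturbPlay V s ε) (measurableSet_othersLe i c)]
  rfl

theorem othersLt_perturbedProfile (c : ℝ≥0) : othersLt V (perturbedProfile V s ε) i c =
    playLaw V s {x | ∀ j, j ≠ i → perturb V s ε j (x j) < c} := by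
  rw [othersLt, playLaw_perturbedProfile,
    Measure.map_apply (measurable_perturbPlay V s ε) (measurableSet_othersLt i c)]
  rfl

theorem othersLe_perturbedProfile_le (c : ℝ≥0) :
    othersLe V (perturbedProfile V s ε) i c ≤ othersLe V s i c := by
  rw [othersLe_perturbedProfile]
  exact measure_mono fun x hx j hj => (le_perturb _).trans (hx j hj)

/-- Against the perturbed bids no deviation achieves more than the original best utility. -/
theorem IsBestBid.interimUtility_perturbedProfile_le {v b : ℝ≥0} (h : IsBestBid V α s i v b)
    (b' : ℝ≥0) :
    interimUtility V α' (perturbedProfile V s ε) i v b' ≤ interimUtility V α s i v b := by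
  rcases le_total b' v with hb | hb
  · refine le_trans (mul_le_mul_of_nonneg_left ?_ (sub_nonneg.2 hb)) (h.mul_othersLe_le hb)
    exact ENNReal.toReal_mono (othersLe_ne_top V s i b')
      ((winMass_le_othersLe _ _ _ _ b').trans (othersLe_perturbedProfile_le b'))
  · refine le_trans (mul_nonpos_of_nonpos_of_nonneg (sub_nonpos.2 hb) ?_) h.utility_nonneg
    exact winProb_nonneg V α' _ i b'

/-- A perturbed bid below the value beats all the perturbed bids that originate from bids that
were not higher. -/
theorem IsBNE.othersLe_le_othersLt_perturb (hs : IsBNE V α s) (hε : 0 < ε) {v b : ℝ≥0}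
    (hreg : IsRegularBid V α s i (v, b)) (hlt : b < v) :
    othersLe V s i b ≤ othersLt V (perturbedProfile V s ε) i (perturb V s ε i (v, b)) := by
  by_cases hF : othersLe V s i b = 0
  · simp [hF]
  rw [othersLt_perturbedProfile]
  have hatom : ∀ᵐ x ∂playLaw V s, ∀ j, (x j).2 ∉ foreignAtoms V s j :=
    ae_all_iff.2 fun j => ae_eval j (ae_notMem_foreignAtoms V s j)
  have hφ : b + ε ≤ perturb V s ε i (v, b) := le_perturb_of_lt (y := (v, b)) hF hlt
  refine measure_mono_ae ?_
  suffices h : ∀ᵐ x ∂playLaw V s, (∀ j, j ≠ i → (x j).2 ≤ b) →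
      ∀ j, j ≠ i → perturb V s ε j (x j) < perturb V s ε i (v, b) from h
  by_cases hN : b ∈ foreignAtoms V s i
  · filter_upwards [hatom] with x hx hall j hj
    have e : perturb V s ε i (v, b) = b + 2 * ε := by
      unfold perturb; simp [hF, hlt, hN]
    rw [e]
    refine (perturb_le_of_notMem (hx j)).trans_lt ?_
    have : ε < 2 * ε := by rw [two_mul]; exact lt_add_of_pos_right _ hε
    exact add_lt_add_of_le_of_lt (hall j hj) this
  -- Outside the foreign atoms, only another shading bidder at exactly `b` could reach the raised
  -- bid.
  suffices h : ∀ᵐ x ∂playLaw V s, ¬ ((∀ j, j ≠ i → (x j).2 ≤ b) ∧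
      ∃ j, j ≠ i ∧ (x j).2 = b ∧ (x j).2 < (x j).1) by
    filter_upwards [h, hatom] with x hx hx' hall j hj
    refine lt_of_lt_of_le ?_ hφ
    rcases (hall j hj).lt_or_eq with hjb | hjb
    · exact (perturb_le_of_notMem (hx' j)).trans_lt (add_lt_add_left hjb ε)
    · by_contra hge
      refine hx ⟨hall, j, hj, hjb, lt_of_lt_perturb (hx' j) (lt_of_lt_of_le ?_ (not_lt.1 hge))⟩
      rw [hjb]
      exact add_lt_add_right (NNReal.half_lt_self hε.ne') _
  by_cases hp : bidderLaw V s i {y | y.2 = b} = 0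
  · have h0 : ∀ j, bidderLaw V s j {y | y.2 = b} = 0 := fun j => by
      by_contra h
      exact hN ⟨hp, j, h⟩
    filter_upwards [ae_all_iff.2 fun j => ae_eval j (measure_eq_zero_iff_ae_notMem.1 (h0 j))]
      with x hx ⟨_, j, _, hj, _⟩
    exact hx j hj
  · refine ae_not_of_indep (fun x y => ?_) hp ?_
    · refine and_congr (forall_congr' fun j => forall_congr' fun hj => ?_)
        (exists_congr fun j => and_congr_right fun hj => ?_) <;> rw [Function.update_of_ne hj]
    · filter_upwards [FirstPriceAuction.ae_winKernel_eq_one (hreg.1 hlt),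
        ae_all_iff.2 fun j => hs.ae_winKernel_eq_one j] with x h1 h2 (hxi : (x i).2 = b)
      rintro ⟨hall, j, hj, hjb, hjv⟩
      have hwi := h1 hall
      have hwj := h2 j hjv fun k _ => by
        by_cases hk : k = i
        · rw [hk, hxi, hjb]
        · rw [hjb]; exact hall k hk
      subst hxi
      change α.toKernel (Function.update (bidProfile x) i (x i).2) {i} = 1 at hwi
      rw [update_bidProfile_self, ← prob_compl_eq_zero_iff (measurableSet_singleton i)] at hwi
      have : α.toKernel (bidProfile x) {j} = 0 :=
        measure_mono_null (fun z hz => by rw [mem_singleton_iff] at hz; subst hz; exact hj) hwi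
      rw [this] at hwj
      exact zero_ne_one hwj

/-- A bidder who can lose with an overbid does not always bid higher than that. -/
theorem IsBNE.bidderLaw_le_ne_zero (hs : IsBNE V α s) {v b : ℝ≥0} (hv : v ∈ (V i).support)
    (hlt : v < b) (hF : othersLe V s i b ≠ 0) : bidderLaw V s i {y | y.2 ≤ b} ≠ 0 := by
  intro h0
  -- Otherwise values below `b`, which have positive probability, would come with overbids above `b`
  -- that can win.
  have h1 : ∀ᵐ y ∂bidderLaw V s i, y.1 ∉ Iio b := by
    filter_upwards [measure_eq_zero_iff_ae_notMem.1 h0, hs.ae_isRegularBid i] with y hy hreg hyb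
    have hby : b < y.2 := not_le.1 hy
    refine hF (nonpos_iff_eq_zero.1 ?_)
    rw [← hreg.2.2 (lt_trans hyb hby)]
    exact (othersLe_le_othersLt V s i hby).trans (othersLt_le_winMass V α s i _)
  have h2 : V i (Iio b) = 0 := by
    have : (bidderLaw V s i).fst = V i := Measure.fst_compProd _ _
    rw [← this, Measure.fst_apply measurableSet_Iio]
    exact measure_eq_zero_iff_ae_notMem.2 h1
  exact (((V i).mem_support_iff_forall v).1 hv _ (Iio_mem_nhds hlt)).ne' h2

/-- An overbid that never wins cannot win after the perturbation either. -/
theorem IsBNE.othersLe_perturbedProfile_eq_zero (hs : IsBNE V α s) (hε : 0 < ε) {v b : ℝ≥0}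
    (hv : v ∈ (V i).support) (hlt : v < b) (hX : winMass V α s i b = 0) :
    othersLe V (perturbedProfile V s ε) i b = 0 := by
  by_cases hF : othersLe V s i b = 0
  · exact nonpos_iff_eq_zero.1 ((othersLe_perturbedProfile_le b).trans hF.le)
  have hpos := hs.bidderLaw_le_ne_zero hv hlt hF
  have hG : othersLt V s i b = 0 :=
    nonpos_iff_eq_zero.1 ((othersLt_le_winMass V α s i b).trans hX.le)
  rw [othersLe_perturbedProfile, measure_eq_zero_iff_ae_notMem]
  -- Test the event on plays where `i` also bids at most `b`. Almost surely the winner bids exactly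
  -- `b`: it is not `i`, who never wins at `b`, and anyone else does not overbid and so was raised
  -- above `b`.
  refine ae_not_of_indep (A := fun x => ∀ j, j ≠ i → perturb V s ε j (x j) ≤ b)
    (fun x y => ?_) hpos ?_
  · exact forall_congr' fun j => forall_congr' fun hj => by rw [Function.update_of_ne hj]
  filter_upwards [FirstPriceAuction.ae_winKernel_eq_zero hX, measure_eq_zero_iff_ae_notMem.1 hG,
    ae_all_iff.2 fun j => hs.ae_winKernel_eq_zero j] with x h1 h2 h3 (hxi : (x i).2 ≤ b) hA
  have hall : ∀ j, (x j).2 ≤ b := fun j => by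
    by_cases hj : j = i
    · rw [hj]; exact hxi
    · exact (le_perturb _).trans (hA j hj)
  obtain ⟨w, hw⟩ := α.exists_apply_ne_zero (bidProfile x)
  have hwb : (x w).2 = b := by
    refine le_antisymm (hall w) (not_lt.1 fun h => h2 fun j _ => ?_)
    exact (α.apply_ne_zero hw j).trans_lt h
  by_cases hwi : w = i
  · subst hwi
    rw [← hwb, update_bidProfile_self] at h1
    exact hw h1
  · have hle : (x w).2 ≤ (x w).1 := not_lt.1 fun h => hw (h3 w h)
    have hFw : othersLe V s w (x w).2 ≠ 0 := hwb ▸ othersLe_ne_zero hF hpos w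
    exact absurd (hA w hwi) (not_le.2 (hwb ▸ lt_perturb_of_le hε hFw hle))

/-- The perturbed bid loses at most `2 * ε` compared to the original best bid. -/
theorem IsBNE.interimUtility_perturb_ge (hs : IsBNE V α s) (hε : 0 < ε) {v b : ℝ≥0}
    (hv : v ∈ (V i).support) (h : IsBestBid V α s i v b) :
    interimUtility V α s i v b - 2 * ε ≤
      interimUtility V α' (perturbedProfile V s ε) i v (perturb V s ε i (v, b)) := by
  have hreg := h.isRegularBid
  set c := perturb V s ε i (v, b) with hc
  have hX1 := winProb_le_one V α' (perturbedProfile V s ε) i c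
  have hX0 := winProb_nonneg V α' (perturbedProfile V s ε) i c
  have hε' : (0 : ℝ) < ε := hε
  have hcb : (c : ℝ) ≤ b + 2 * ε := by exact_mod_cast perturb_le (V := V) (s := s) (i := i) (v, b)
  rcases lt_trichotomy b v with hlt | heq | hgt
  · have hlt' : (b : ℝ) < v := hlt
    have hFX : (othersLe V s i b).toReal ≤ winProb V α' (perturbedProfile V s ε) i c :=
      ENNReal.toReal_mono (winMass_ne_top _ _ _ _ _)
        ((hs.othersLe_le_othersLt_perturb hε hreg hlt).trans (othersLt_le_winMass _ _ _ _ _))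
    have hu : interimUtility V α s i v b = ((v : ℝ) - b) * (othersLe V s i b).toReal := by
      rw [interimUtility, winProb_eq, show winMass V α s i b = _ from hreg.1 hlt]
    rw [hu, interimUtility]
    have hF0 : 0 ≤ (othersLe V s i b).toReal := ENNReal.toReal_nonneg
    generalize (othersLe V s i b).toReal = F at *
    generalize winProb V α' (perturbedProfile V s ε) i c = X at *
    rcases le_total (c : ℝ) v with hcv | hcv
    · have h1 : ((v : ℝ) - c) * F ≤ (v - c) * X := mul_le_mul_of_nonneg_left hFX (sub_nonneg.2 hcv)
      nlinarith [mul_nonneg hF0 (sub_nonneg.2 hcb), mul_nonneg hε'.le (sub_nonneg.2 (hFX.trans hX1))]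
    -- If the raise overshoots the value, the loss is at most `c - v ≤ 2 * ε - (v - b)`, while the
    -- old utility was at most `v - b`.
    · nlinarith [mul_nonneg (sub_nonneg.2 hcv) (sub_nonneg.2 hX1),
        mul_nonneg (sub_pos.2 hlt').le (sub_nonneg.2 (hFX.trans hX1))]
  · have hu : interimUtility V α s i v b = 0 := by rw [heq, interimUtility, sub_self, zero_mul]
    rw [hu, interimUtility]
    have hbv : (b : ℝ) = v := congrArg _ heq
    have hbc : (b : ℝ) ≤ c := by exact_mod_cast le_perturb (V := V) (s := s) (ε := ε) (i := i) (v, b)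
    nlinarith [mul_nonneg (sub_nonneg.2 hbc) (sub_nonneg.2 hX1)]
  · have hXb := hreg.2.2 hgt
    have e : c = b := perturb_of_lt (y := (v, b)) hgt
    have hX' : winMass V α' (perturbedProfile V s ε) i b = 0 := nonpos_iff_eq_zero.1
      ((winMass_le_othersLe _ _ _ _ _).trans (hs.othersLe_perturbedProfile_eq_zero hε hv hgt hXb).le)
    rw [e, interimUtility, interimUtility, winProb_eq, winProb_eq, hX',
      show winMass V α s i b = 0 from hXb]
    simp

theorem measurable_interimUtility (V : Fin n → Measure ℝ≥0) [∀ i, IsProbabilityMeasure (V i)]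
    (α : TieBreakingRule n) (s : StrategyProfile n) (i : Fin n) (v : ℝ≥0) :
    Measurable (interimUtility V α s i v) := by
  have : Measurable (winProb V α s i) := (measurable_winMass V α s i).ennreal_toReal
  unfold interimUtility; fun_prop

/-- The old best utility at `v` bounds every deviation from above and, less `2 * ε`, almost every
perturbed bid from below; the same two bounds give integrability. -/
theorem IsBNE.isApproxBNE_perturbedProfile (hs : IsBNE V α s) (hε : 0 < ε)
    (α' : TieBreakingRule n) : IsApproxBNE V α' (perturbedProfile V s ε) (2 * ε) := by
  intro i v hv
  obtain ⟨b₀, hb₀⟩ := (hs.ae_isBestBid hv).exists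
  have hφ : Measurable fun b => perturb V s ε i (v, b) :=
    (measurable_perturb V s ε i).comp measurable_prodMk_left
  have hu := measurable_interimUtility V α' (perturbedProfile V s ε) i v
  have hge : ∀ᵐ b ∂s.toKernel i v, interimUtility V α s i v b₀ - 2 * ε ≤
      interimUtility V α' (perturbedProfile V s ε) i v (perturb V s ε i (v, b)) := by
    filter_upwards [hs.ae_isBestBid hv] with b hb
    exact (sub_le_sub_right (hb b₀) _).trans (hs.interimUtility_perturb_ge hε hv hb)
  have hint : Integrable (fun b => interimUtility V α' (perturbedProfile V s ε) i v
      (perturb V s ε i (v, b))) (s.toKernel i v) := by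
    refine Integrable.of_mem_Icc (interimUtility V α s i v b₀ - 2 * ε) (interimUtility V α s i v b₀) (hu.comp hφ).aemeasurable ?_
    filter_upwards [hge] with b hb
    exact ⟨hb, hb₀.interimUtility_perturbedProfile_le _⟩
  rw [perturbedProfile_apply]
  refine ⟨(integrable_map_measure hu.aestronglyMeasurable hφ.aemeasurable).2 hint, fun b' => ?_⟩
  rw [integral_map hφ.aemeasurable hu.aestronglyMeasurable]
  refine (sub_le_sub_right (hb₀.interimUtility_perturbedProfile_le b') _).trans ?_
  have := integral_mono_ae (integrable_const _) hint hge
  simpa using this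

end Equilibrium

end FirstPriceAuction

end


theorem mainTheorem3 (n : ℕ) (V : Fin n → MeasureTheory.Measure ℝ≥0)
    [∀ i, MeasureTheory.IsProbabilityMeasure (V i)]
    (α : FirstPriceAuction.TieBreakingRule n) (s : FirstPriceAuction.StrategyProfile n)
    (hs : FirstPriceAuction.IsBNE V α s) (δ : ℝ) (hδ : 0 < δ) :
    ∃ s' : FirstPriceAuction.StrategyProfile n,
      (∀ i : Fin n, ∀ v ∈ (V i).support,
        FirstPriceAuction.emdInfty (s.toKernel i v) (s'.toKernel i v) ≤ ENNReal.ofReal δ) ∧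
      (∀ α' : FirstPriceAuction.TieBreakingRule n,
        FirstPriceAuction.optimalWelfare V α' s' = FirstPriceAuction.optimalWelfare V α s ∧
        FirstPriceAuction.auctionWelfare V α' s' = FirstPriceAuction.auctionWelfare V α s) ∧
      (∀ α' : FirstPriceAuction.TieBreakingRule n,
        FirstPriceAuction.IsApproxBNE V α' s' δ) := by
  open FirstPriceAuction in
  -- Both the largest raise and the largest loss of utility are `2 * ε`, hence `ε = δ / 2`.
  have hε : 0 < δ.toNNReal / 2 := half_pos (Real.toNNReal_pos.2 hδ)
  have h2 : 2 * (δ.toNNReal / 2) = δ.toNNReal := mul_div_cancel₀ _ two_ne_zero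
  refine ⟨perturbedProfile V s (δ.toNNReal / 2), fun i v _ => ?_, fun α' =>
    ⟨optimalWelfare_perturbedProfile α', hs.auctionWelfare_perturbedProfile hε α'⟩, fun α' => ?_⟩
  · rw [perturbedProfile_apply]
    refine (emdInfty_map_le (f := fun b => perturb V s _ i (v, b))
      ((measurable_perturb V s _ i).comp measurable_prodMk_left)
      (fun b => le_perturb (v, b)) (fun b => perturb_le (v, b))).trans ?_
    rw [h2]; rfl
  · have := hs.isApproxBNE_perturbedProfile hε α'
    have e : (2 : ℝ) * ((δ.toNNReal / 2 : ℝ≥0) : ℝ) = δ := by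
      rw [← Real.coe_toNNReal δ hδ.le, Real.toNNReal_coe]; exact_mod_cast h2
    rwa [e] at this
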